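/- Let $A_1,\dots,A_M\in\mathbb{R}^{n\times n}$ and $b_1,\dots,b_M\in\mathbb{R}^n$. Let $\mathcal{S}$ be the set of switching signals, i.e. of right-continuous functions $\sigma:[0,\infty)\to\{1,\dots,M\}$ with finitely many discontinuity points in every bounded interval. For $\sigma\in\mathcal{S}$ let $\Psi_\sigma(t,x)$ be the value at time $t\ge 0$ of the solution of $\dot x(t)=A_{\sigma(t)}x(t)+b_{\sigma(t)}$ starting at $x(0)=x$, and let $\Phi_\sigma(t,0)x$ be the value at time $t$ of the solution of the linearized system $\dot x(t)=A_{\sigma(t)}x(t)$ starting at $x$. For $\tau>0$ let $\mathcal{S}_{\mathrm{dw}}(\tau)$ be the set of all $\sigma\in\mathcal{S}$ whose discontinuity points $t_1<t_2<\cdots$ in $(0,\infty)$ satisfy $t_k-t_{k-1}\ge\tau$ for all $k\ge 1$, where $t_0:=0$. A compact set $C\subset\mathbb{R}^n$ is called forward invariant on $\mathcal{S}_{\mathrm{dw}}(\tau)$ if $\Psi_\sigma(t,x)\in C$ for all $x\in C$, $\sigma\in\mathcal{S}_{\mathrm{dw}}(\tau)$ and $t\ge 0$. Suppose that the linearized system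 is unstable on $\mathcal{S}$, i.e. there exist $x\in\mathbb{R}^n$ and $\sigma\in\mathcal{S}$ with $\limsup_{t\to\infty}|\Phi_\sigma(t,0)x|=+\infty$. Then: 1. for every $\tau>0$ there is no compact set with non-empty interior that is forward invariant on $\mathcal{S}_{\mathrm{dw}}(\tau)$; 2. if moreover $\{A_1,\dots,A_M\}$ is irreducible, i.e. $\{0\}$ and $\mathbb{R}^n$ are the only vector subspaces of $\mathbb{R}^n$ invariant under all the $A_i$, then for every $\tau>0$ there is no non-empty compact set, other than singletons, that is forward invariant on $\mathcal{S}_{\mathrm{dw}}(\tau)$. -/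

import Mathlib

open Filter Topology Set
open scoped NNReal

noncomputable section

namespace SwitchedAffine

/-- Switching signals: piecewise constant (finitely many discontinuity points in every bounded
interval of `[0, ∞)`), right-continuous functions from `[0, ∞)` to the set of the `M` modes, which
carries the discrete topology. -/
structure SwitchingSignal (M : ℕ) where
  toFun : ℝ≥0 → Fin M
  finite_discontinuities : ∀ T : ℝ≥0, {t : ℝ≥0 | t ≤ T ∧ ¬ ContinuousAt toFun t}.Finite
  right_continuous : ∀ t : ℝ≥0, ContinuousWithinAt toFun (Ici t) t

/-- The switching instants (discontinuity points) of a signal. -/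
def SwitchingSignal.switchingTimes {M : ℕ} (σ : SwitchingSignal M) : Set ℝ≥0 :=
  {t | ¬ ContinuousAt σ.toFun t}

/-- Signals with dwell time `τ`: two distinct switching instants are at distance at least `τ`, where
the initial time `0` counts as a switching instant. As the switching instants are locally finite,
asking this of all pairs is the same as asking it of consecutive ones. -/
def dwellTimeSignals (M : ℕ) (τ : ℝ) : Set (SwitchingSignal M) :=
  {σ | ∀ s ∈ insert 0 σ.switchingTimes, ∀ t ∈ σ.switchingTimes, s < t → τ ≤ (t : ℝ) - (s : ℝ)}

variable {n M : ℕ}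

/-- The right-hand side `A_{σ(t)} y + b_{σ(t)}` (for negative times, which play no role, `t` is
replaced by `0`). -/
def field (A : Fin M → Matrix (Fin n) (Fin n) ℝ) (b : Fin M → EuclideanSpace ℝ (Fin n))
    (σ : SwitchingSignal M) (t : ℝ) (y : EuclideanSpace ℝ (Fin n)) : EuclideanSpace ℝ (Fin n) :=
  Matrix.toEuclideanCLM (n := Fin n) (𝕜 := ℝ) (A (σ.toFun t.toNNReal)) y + b (σ.toFun t.toNNReal)

/-- `x` solves `x' = A_{σ(t)} x + b_{σ(t)}` on `[0, T)` and is continuous on `[0, T]`, `x(0) = x₀`.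
The signal being right-continuous, the equation is imposed with the right derivative at every time;
at the times where the signal is continuous the two-sided derivative then exists as well. -/
def IsSolutionUpTo (A : Fin M → Matrix (Fin n) (Fin n) ℝ) (b : Fin M → EuclideanSpace ℝ (Fin n))
    (σ : SwitchingSignal M) (x₀ : EuclideanSpace ℝ (Fin n)) (T : ℝ)
    (x : ℝ → EuclideanSpace ℝ (Fin n)) : Prop :=
  x 0 = x₀ ∧ ContinuousOn x (Icc 0 T) ∧
    ∀ t ∈ Ico 0 T, HasDerivWithinAt x (field A b σ t (x t)) (Ici t) t

/-- `x` is the solution of `x' = A_{σ(t)} x + b_{σ(t)}`, `x(0) = x₀`, on `[0, ∞)`. -/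
def IsSolution (A : Fin M → Matrix (Fin n) (Fin n) ℝ) (b : Fin M → EuclideanSpace ℝ (Fin n))
    (σ : SwitchingSignal M) (x₀ : EuclideanSpace ℝ (Fin n))
    (x : ℝ → EuclideanSpace ℝ (Fin n)) : Prop :=
  x 0 = x₀ ∧ ContinuousOn x (Ici 0) ∧
    ∀ t ∈ Ici (0 : ℝ), HasDerivWithinAt x (field A b σ t (x t)) (Ici t) t

theorem IsSolutionUpTo.eqOn {A : Fin M → Matrix (Fin n) (Fin n) ℝ}
    {b : Fin M → EuclideanSpace ℝ (Fin n)} {σ : SwitchingSignal M} {x₀ : EuclideanSpace ℝ (Fin n)}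
    {T : ℝ} {x y : ℝ → EuclideanSpace ℝ (Fin n)} (hx : IsSolutionUpTo A b σ x₀ T x)
    (hy : IsSolutionUpTo A b σ x₀ T y) : EqOn x y (Icc 0 T) := by
  classical
  let K : ℝ≥0 := ∑ i, ‖Matrix.toEuclideanCLM (n := Fin n) (𝕜 := ℝ) (A i)‖₊
  refine ODE_solution_unique_of_mem_Icc_right (v := field A b σ) (s := fun _ => univ) (K := K)
    ?_ hx.2.1 hx.2.2 (fun _ _ => mem_univ _) hy.2.1 hy.2.2 (fun _ _ => mem_univ _)
    (hx.1.trans hy.1.symm)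
  intro t _
  rw [lipschitzOnWith_univ]
  refine LipschitzWith.of_dist_le_mul fun u v => ?_
  simp only [field, dist_add_right]
  refine ((Matrix.toEuclideanCLM (n := Fin n) (𝕜 := ℝ)
    (A (σ.toFun t.toNNReal))).lipschitz.dist_le_mul u v).trans ?_
  refine mul_le_mul_of_nonneg_right ?_ dist_nonneg
  exact_mod_cast Finset.single_le_sum
    (f := fun i => ‖Matrix.toEuclideanCLM (n := Fin n) (𝕜 := ℝ) (A i)‖₊)
    (fun _ _ => zero_le) (Finset.mem_univ (σ.toFun t.toNNReal))

theorem exists_affine_solution {E : Type*} [NormedAddCommGroup E] [NormedSpace ℝ E]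
    [CompleteSpace E] (L : E →L[ℝ] E) (c : E) (s : ℝ) (y₀ : E) :
    ∃ y : ℝ → E, y s = y₀ ∧ ∀ t, HasDerivAt y (L (y t) + c) t := by
  let _ : NormedAlgebra ℚ (E →L[ℝ] E) := NormedAlgebra.restrictScalars ℚ ℝ (E →L[ℝ] E)
  have hcont : Continuous fun t : ℝ => NormedSpace.exp (-(t • L)) c := by
    have h1 : Continuous fun t : ℝ => NormedSpace.exp (-(t • L)) :=
      NormedSpace.exp_continuous.comp (by fun_prop)
    exact h1.clm_apply continuous_const
  have hinv : ∀ t : ℝ, NormedSpace.exp (t • L) * NormedSpace.exp (-(t • L)) = 1 := by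
    intro t
    rw [← NormedSpace.exp_add_of_commute (Commute.neg_right (Commute.refl _))]
    simp
  refine ⟨fun t => NormedSpace.exp (t • L)
    (NormedSpace.exp (-(s • L)) y₀ + ∫ r in s..t, NormedSpace.exp (-(r • L)) c), ?_, ?_⟩
  · have := congrArg (fun F : E →L[ℝ] E => F y₀) (hinv s)
    simpa using this
  · intro t
    have h1 : HasDerivAt (fun t : ℝ => NormedSpace.exp (t • L)) (L * NormedSpace.exp (t • L)) t :=
      hasDerivAt_exp_smul_const' L t
    have h2 : HasDerivAt (fun t : ℝ => NormedSpace.exp (-(s • L)) y₀ +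
        ∫ r in s..t, NormedSpace.exp (-(r • L)) c) (NormedSpace.exp (-(t • L)) c) t :=
      (intervalIntegral.integral_hasDerivAt_right (hcont.intervalIntegrable _ _)
        (hcont.stronglyMeasurableAtFilter _ _) hcont.continuousAt).const_add _
    have h3 := h1.clm_apply h2
    have h4 := congrArg (fun F : E →L[ℝ] E => F c) (hinv t)
    simp only [mul_apply_eq_comp, one_apply_eq_self] at h4
    simpa [h4] using h3

theorem SwitchingSignal.eq_of_no_switch (σ : SwitchingSignal M) {s T : ℝ}
    (h : ∀ t ∈ Ioo s T, t.toNNReal ∉ σ.switchingTimes) {t : ℝ} (ht : t ∈ Ico s T) :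
    σ.toFun t.toNNReal = σ.toFun s.toNNReal := by
  have hc : ContinuousOn (fun t : ℝ => σ.toFun t.toNNReal) (Ico s T) := by
    intro r hr
    rcases eq_or_lt_of_le hr.1 with rfl | hlt
    · refine ContinuousWithinAt.comp (t := Ici s.toNNReal) (σ.right_continuous s.toNNReal)
        continuous_real_toNNReal.continuousWithinAt ?_
      intro u hu
      exact Real.toNNReal_le_toNNReal hu.1
    · have h1 : ContinuousAt σ.toFun r.toNNReal := not_not.mp (h r ⟨hlt, hr.2⟩)
      exact (ContinuousAt.comp (f := Real.toNNReal) h1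
        continuous_real_toNNReal.continuousAt).continuousWithinAt
  exact isPreconnected_Ico.constant hc ht ⟨le_rfl, ht.1.trans_lt ht.2⟩

theorem exists_isSolutionUpTo (A : Fin M → Matrix (Fin n) (Fin n) ℝ)
    (b : Fin M → EuclideanSpace ℝ (Fin n)) (σ : SwitchingSignal M)
    (x₀ : EuclideanSpace ℝ (Fin n)) (T : ℝ) : ∃ x, IsSolutionUpTo A b σ x₀ T x := by
  have extend : ∀ s T : ℝ, 0 ≤ s → s ≤ T → (∃ x, IsSolutionUpTo A b σ x₀ s x) →
      (∀ t ∈ Ioo s T, t.toNNReal ∉ σ.switchingTimes) → ∃ x, IsSolutionUpTo A b σ x₀ T x := by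
    rintro s T hs hsT ⟨x, hx0, hxc, hxd⟩ hno
    obtain ⟨y, hys, hy⟩ := exists_affine_solution
      (Matrix.toEuclideanCLM (n := Fin n) (𝕜 := ℝ) (A (σ.toFun s.toNNReal)))
      (b (σ.toFun s.toNNReal)) s (x s)
    have hyc : Continuous y := continuous_iff_continuousAt.2 fun t => (hy t).continuousAt
    have hz1 : ∀ t, t ≤ s → (if t ≤ s then x t else y t) = x t := fun t ht => if_pos ht
    have hz2 : ∀ t, s ≤ t → (if t ≤ s then x t else y t) = y t := by
      intro t ht
      split_ifs with h
      · rw [le_antisymm h ht, hys]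
      · rfl
    refine ⟨fun t => if t ≤ s then x t else y t, ?_, ?_, ?_⟩
    · exact (hz1 0 hs).trans hx0
    · have hU : Icc 0 T = Icc 0 s ∪ Icc s T := (Icc_union_Icc_eq_Icc hs hsT).symm
      rw [hU]
      refine ContinuousOn.union_of_isClosed ?_ ?_ isClosed_Icc isClosed_Icc
      · exact hxc.congr fun t ht => hz1 t ht.2
      · exact hyc.continuousOn.congr fun t ht => hz2 t ht.1
    · intro t ht
      rcases lt_or_ge t s with hts | hts
      · have := hxd t ⟨ht.1, hts⟩
        simp only [hz1 t hts.le]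
        refine this.congr_of_eventuallyEq ?_ (hz1 t hts.le)
        filter_upwards [mem_nhdsWithin_of_mem_nhds (Iio_mem_nhds hts)] with u hu
        exact hz1 u (le_of_lt hu)
      · simp only [hz2 t hts]
        have h1 := (hy t).hasDerivWithinAt (s := Ici t)
        have h2 : field A b σ t (y t) = Matrix.toEuclideanCLM (n := Fin n) (𝕜 := ℝ)
            (A (σ.toFun s.toNNReal)) (y t) + b (σ.toFun s.toNNReal) := by
          rw [field, σ.eq_of_no_switch hno ⟨hts, ht.2⟩]
        rw [h2]
        exact h1.congr (fun u hu => hz2 u (hts.trans hu)) (hz2 t hts)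
  have zero : ∃ x, IsSolutionUpTo A b σ x₀ 0 x :=
    ⟨fun _ => x₀, rfl, continuousOn_const, fun t ht => absurd ht.2 (not_lt.2 ht.1)⟩
  have hfin : ∀ T : ℝ, {t : ℝ | t ∈ Ioo 0 T ∧ t.toNNReal ∈ σ.switchingTimes}.Finite := by
    intro T
    refine ((σ.finite_discontinuities T.toNNReal).image ((↑) : ℝ≥0 → ℝ)).subset ?_
    rintro t ⟨ht, hts⟩
    exact ⟨t.toNNReal, ⟨Real.toNNReal_le_toNNReal ht.2.le, hts⟩, Real.coe_toNNReal t ht.1.le⟩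
  have main : ∀ k : ℕ, ∀ T : ℝ, 0 ≤ T →
      {t : ℝ | t ∈ Ioo 0 T ∧ t.toNNReal ∈ σ.switchingTimes}.ncard = k →
      ∃ x, IsSolutionUpTo A b σ x₀ T x := by
    intro k
    induction k using Nat.strong_induction_on with
    | _ k ih =>
      intro T hT hk
      rcases Set.eq_empty_or_nonempty
        {t : ℝ | t ∈ Ioo 0 T ∧ t.toNNReal ∈ σ.switchingTimes} with he | hne
      · refine extend 0 T le_rfl hT zero fun t ht hts => ?_
        have : t ∈ {t : ℝ | t ∈ Ioo 0 T ∧ t.toNNReal ∈ σ.switchingTimes} := ⟨ht, hts⟩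
        rw [he] at this
        exact this
      · obtain ⟨s, hsD, hmax⟩ := Set.exists_max_image _ id (hfin T) hne
        have hlt : {t : ℝ | t ∈ Ioo 0 s ∧ t.toNNReal ∈ σ.switchingTimes}.ncard < k := by
          rw [← hk]
          refine Set.ncard_lt_ncard ⟨?_, ?_⟩ (hfin T)
          · exact fun t ht => ⟨⟨ht.1.1, ht.1.2.trans hsD.1.2⟩, ht.2⟩
          · exact fun hsub => lt_irrefl s (hsub hsD).1.2
        refine extend s T hsD.1.1.le hsD.1.2.le (ih _ hlt s hsD.1.1.le rfl) fun t ht hts => ?_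
        exact absurd (hmax t ⟨⟨hsD.1.1.trans ht.1, ht.2⟩, hts⟩) (not_le.2 ht.1)
  rcases le_total 0 T with hT | hT
  · exact main _ T hT rfl
  · obtain ⟨x, hx0, -, -⟩ := zero
    refine ⟨fun _ => x₀, rfl, continuousOn_const, fun t ht => ?_⟩
    exact absurd (ht.1.trans_lt ht.2) (not_lt.2 hT)

/-- The initial value problem has a solution on `[0, ∞)`; it is unique by `IsSolution.eqOn`. -/
theorem exists_isSolution (A : Fin M → Matrix (Fin n) (Fin n) ℝ)
    (b : Fin M → EuclideanSpace ℝ (Fin n)) (σ : SwitchingSignal M)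
    (x₀ : EuclideanSpace ℝ (Fin n)) : ∃ x, IsSolution A b σ x₀ x := by
  choose X hX using exists_isSolutionUpTo A b σ x₀
  have hagree : ∀ S T t : ℝ, 0 ≤ t → t ≤ S → S ≤ T → X S t = X T t := by
    intro S T t h0 h1 h2
    have hT : IsSolutionUpTo A b σ x₀ S (X T) := ⟨(hX T).1,
      (hX T).2.1.mono (Icc_subset_Icc_right h2), fun u hu => (hX T).2.2 u ⟨hu.1, hu.2.trans_le h2⟩⟩
    exact (hX S).eqOn hT ⟨h0, h1⟩
  have hloc : ∀ T t : ℝ, 0 ≤ t → t ≤ T → X t t = X T t := fun T t h0 h1 =>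
    hagree t T t h0 le_rfl h1
  refine ⟨fun t => X t t, (hX 0).1, ?_, ?_⟩
  · intro t ht
    have h1 : ContinuousWithinAt (X (t + 1)) (Ici 0) t := by
      refine ((hX (t + 1)).2.1 t ⟨ht, by linarith⟩).mono_of_mem_nhdsWithin ?_
      rw [← Ici_inter_Iic]
      exact inter_mem self_mem_nhdsWithin (mem_nhdsWithin_of_mem_nhds (Iic_mem_nhds (by linarith)))
    refine h1.congr_of_eventuallyEq ?_ (hloc (t + 1) t ht (by linarith))
    filter_upwards [self_mem_nhdsWithin,
      mem_nhdsWithin_of_mem_nhds (Iic_mem_nhds (show t < t + 1 by linarith))] with u hu hu'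
    exact hloc (t + 1) u hu hu'
  · intro t ht
    have h1 := (hX (t + 1)).2.2 t ⟨ht, by linarith⟩
    have h2 := hloc (t + 1) t ht (by linarith)
    simp only [h2]
    refine h1.congr_of_eventuallyEq ?_ h2
    filter_upwards [self_mem_nhdsWithin,
      mem_nhdsWithin_of_mem_nhds (Iic_mem_nhds (show t < t + 1 by linarith))] with u hu hu'
    exact hloc (t + 1) u (le_trans ht hu) hu'

theorem IsSolution.eqOn {A : Fin M → Matrix (Fin n) (Fin n) ℝ}
    {b : Fin M → EuclideanSpace ℝ (Fin n)} {σ : SwitchingSignal M} {x₀ : EuclideanSpace ℝ (Fin n)}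
    {x y : ℝ → EuclideanSpace ℝ (Fin n)} (hx : IsSolution A b σ x₀ x)
    (hy : IsSolution A b σ x₀ y) : EqOn x y (Ici 0) := by
  intro t ht
  have h1 : ∀ {z}, IsSolution A b σ x₀ z → IsSolutionUpTo A b σ x₀ t z := fun hz =>
    ⟨hz.1, hz.2.1.mono Icc_subset_Ici_self, fun u hu => hz.2.2 u hu.1⟩
  exact (h1 hx).eqOn (h1 hy) ⟨ht, le_rfl⟩

/-- The flow map: the value at time `t ≥ 0` of the unique solution starting at `x₀`. -/
def flow (A : Fin M → Matrix (Fin n) (Fin n) ℝ) (b : Fin M → EuclideanSpace ℝ (Fin n))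
    (σ : SwitchingSignal M) (t : ℝ≥0) (x₀ : EuclideanSpace ℝ (Fin n)) : EuclideanSpace ℝ (Fin n) :=
  (exists_isSolution A b σ x₀).choose t

theorem IsSolution.eq_flow {A : Fin M → Matrix (Fin n) (Fin n) ℝ}
    {b : Fin M → EuclideanSpace ℝ (Fin n)} {σ : SwitchingSignal M} {x₀ : EuclideanSpace ℝ (Fin n)}
    {x : ℝ → EuclideanSpace ℝ (Fin n)} (hx : IsSolution A b σ x₀ x) (t : ℝ≥0) :
    x t = flow A b σ t x₀ :=
  hx.eqOn (exists_isSolution A b σ x₀).choose_spec t.2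

/-- The flow of the linearization `x' = A_{σ(t)} x`, that is, `x₀ ↦ Φ_σ(t, 0) x₀`. -/
def linearizedFlow (A : Fin M → Matrix (Fin n) (Fin n) ℝ) (σ : SwitchingSignal M) (t : ℝ≥0)
    (x₀ : EuclideanSpace ℝ (Fin n)) : EuclideanSpace ℝ (Fin n) :=
  flow A 0 σ t x₀

/-- The linearization is unstable on the class `𝒮`: some trajectory of it, with a signal in `𝒮`,
has `limsup_{t → ∞} |Φ_σ(t, 0) x| = +∞` (in the extended reals). -/
def LinearizationUnstableOn (A : Fin M → Matrix (Fin n) (Fin n) ℝ)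
    (𝒮 : Set (SwitchingSignal M)) : Prop :=
  ∃ x : EuclideanSpace ℝ (Fin n), ∃ σ ∈ 𝒮,
    limsup (fun t : ℝ≥0 => ((‖linearizedFlow A σ t x‖ : ℝ) : EReal)) atTop = ⊤

/-- `C` is forward invariant for `x' = A_{σ(t)} x + b_{σ(t)}` on the class `𝒮`. -/
def ForwardInvariantOn (A : Fin M → Matrix (Fin n) (Fin n) ℝ)
    (b : Fin M → EuclideanSpace ℝ (Fin n)) (𝒮 : Set (SwitchingSignal M))
    (C : Set (EuclideanSpace ℝ (Fin n))) : Prop :=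
  ∀ x ∈ C, ∀ σ ∈ 𝒮, ∀ t : ℝ≥0, flow A b σ t x ∈ C

/-- The only subspaces invariant under all the matrices are `{0}` and the whole space. -/
def IrreducibleFamily (A : Fin M → Matrix (Fin n) (Fin n) ℝ) : Prop :=
  ∀ W : Submodule ℝ (EuclideanSpace ℝ (Fin n)),
    (∀ i, ∀ w ∈ W, Matrix.toEuclideanCLM (n := Fin n) (𝕜 := ℝ) (A i) w ∈ W) → W = ⊥ ∨ W = ⊤

end SwitchedAffine

end

namespace SwitchedAffine

open Filter Topology Set
open scoped NNReal

/-! The proof compares the linear semigroup generated by the `exp (t • A i)`, `t ≥ 0`, with an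
invariant set through the subspace `V` of vectors with bounded orbit under it.

A constant signal has no switching instants, hence every dwell time, so an invariant `C` can be
moved by any single mode for any duration, and then by another. Differences of points of `C` thereby
evolve under the whole semigroup and remain differences of points of `C`; if `C` is bounded, `C - C`
lies in `V` (`ForwardInvariantOn.sub_mem_boundedOrbits`).

Every linearized trajectory is an orbit of the semigroup, so instability forces `V ≠ ⊤`. Non-empty
interior of `C` would give `V = ⊤`. As `V` is invariant under all the modes
(`apply_mem_boundedOrbits`), irreducibility leaves only `V = ⊥`, which makes `C` a singleton. -/

/-! ### The linear semigroup and its bounded orbits -/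

/-- The semigroup generated by the flows `exp (t • L i)`, `t ≥ 0`, of the linear modes. -/
def modeSemigroup {ι E : Type*} [NormedAddCommGroup E] [NormedSpace ℝ E] (L : ι → E →L[ℝ] E) :
    Submonoid (E →L[ℝ] E) :=
  Submonoid.closure {g | ∃ i, ∃ t : ℝ, 0 ≤ t ∧ g = NormedSpace.exp (t • L i)}

/-- The subspace of the vectors with bounded orbit under a semigroup of operators. -/
def boundedOrbits {E : Type*} [NormedAddCommGroup E] [NormedSpace ℝ E]
    (K : Submonoid (E →L[ℝ] E)) : Submodule ℝ E where
  carrier := {x | ∃ D : ℝ, ∀ g ∈ K, ‖g x‖ ≤ D}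
  zero_mem' := ⟨0, fun g _ => by simp⟩
  add_mem' := by
    rintro x y ⟨D, hD⟩ ⟨D', hD'⟩
    refine ⟨D + D', fun g hg => ?_⟩
    rw [map_add]
    exact (norm_add_le _ _).trans (add_le_add (hD g hg) (hD' g hg))
  smul_mem' := by
    rintro c x ⟨D, hD⟩
    refine ⟨‖c‖ * D, fun g hg => ?_⟩
    rw [map_smul, norm_smul]
    exact mul_le_mul_of_nonneg_left (hD g hg) (norm_nonneg _)

section

variable {E : Type*} [NormedAddCommGroup E] [NormedSpace ℝ E]

theorem eq_exp_of_hasDerivWithinAt [CompleteSpace E] {L : E →L[ℝ] E} {x : ℝ → E} {s T : ℝ}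
    (hsT : s ≤ T) (hc : ContinuousOn x (Icc s T))
    (hd : ∀ t ∈ Ico s T, HasDerivWithinAt x (L (x t)) (Ici t) t) :
    x T = NormedSpace.exp ((T - s) • L) (x s) := by
  refine ODE_solution_unique_of_mem_Icc_right (v := fun _ => L) (s := fun _ => univ)
    (g := fun t => NormedSpace.exp ((t - s) • L) (x s)) (K := ‖L‖₊)
    (fun t _ => L.lipschitz.lipschitzOnWith) hc hd (fun _ _ => mem_univ _) ?_ ?_
    (fun _ _ => mem_univ _) (by simp) (right_mem_Icc.2 hsT)
  all_goals
    have hg : ∀ t, HasDerivAt (fun t : ℝ => NormedSpace.exp ((t - s) • L) (x s))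
        (L (NormedSpace.exp ((t - s) • L) (x s))) t := by
      intro t
      have h := ((hasDerivAt_exp_smul_const' (𝕂 := ℝ) L (t - s)).comp_sub_const t s).clm_apply
        (hasDerivAt_const t (x s))
      simpa using h
  · exact fun t _ => (hg t).continuousAt.continuousWithinAt
  · exact fun t _ => (hg t).hasDerivWithinAt

/-- The subspace is stable under each `exp (t • L i)`, `t ≥ 0`, since composing with it on the right
stays in the semigroup. Differentiating at `t = 0` from the right gives stability under `L i`,
because a finite-dimensional subspace is closed. -/
theorem apply_mem_boundedOrbits [FiniteDimensional ℝ E] {ι : Type*} (L : ι → E →L[ℝ] E) (i : ι)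
    {w : E} (hw : w ∈ boundedOrbits (modeSemigroup L)) :
    L i w ∈ boundedOrbits (modeSemigroup L) := by
  have : CompleteSpace E := FiniteDimensional.complete ℝ E
  have hexp : ∀ t : ℝ, 0 ≤ t →
      NormedSpace.exp (t • L i) w ∈ boundedOrbits (modeSemigroup L) := by
    intro t ht
    obtain ⟨D, hD⟩ := hw
    exact ⟨D, fun g hg => hD _ (mul_mem hg (Submonoid.subset_closure ⟨i, t, ht, rfl⟩))⟩
  have hder : HasDerivAt (fun t : ℝ => NormedSpace.exp (t • L i) w) (L i w) 0 := by
    simpa using (hasDerivAt_exp_smul_const' (𝕂 := ℝ) (L i) (0 : ℝ)).clm_apply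
      (hasDerivAt_const (0 : ℝ) w)
  have hlim := hasDerivWithinAt_iff_tendsto_slope.1 (hder.hasDerivWithinAt (s := Ici 0))
  -- The slopes are now taken over `t > 0` only, where the exponential belongs to the semigroup.
  rw [Ici_sdiff_left] at hlim
  refine (Submodule.closed_of_finiteDimensional
    (boundedOrbits (modeSemigroup L))).mem_of_tendsto hlim ?_
  filter_upwards [self_mem_nhdsWithin] with t ht
  exact Submodule.smul_mem _ _ (Submodule.sub_mem _ (hexp t (le_of_lt ht)) (hexp 0 le_rfl))

end

variable {n M : ℕ}

/-! ### Differences of points of an invariant set -/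

/-- The operator of each mode on Euclidean space. -/
noncomputable abbrev modeOperator (A : Fin M → Matrix (Fin n) (Fin n) ℝ) (i : Fin M) :
    EuclideanSpace ℝ (Fin n) →L[ℝ] EuclideanSpace ℝ (Fin n) :=
  Matrix.toEuclideanCLM (n := Fin n) (𝕜 := ℝ) (A i)

/-- The signal that stays in one mode. -/
def constantSignal (i : Fin M) : SwitchingSignal M where
  toFun _ := i
  finite_discontinuities T := by
    simp only [continuousAt_const, not_true, and_false, Set.ofPred_false, finite_empty]
  right_continuous _ := continuousWithinAt_const

theorem constantSignal_mem_dwellTimeSignals (i : Fin M) (τ : ℝ) :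
    constantSignal i ∈ dwellTimeSignals M τ :=
  fun _ _ _ ht => (ht continuousAt_const).elim

theorem isSolution_flow (A : Fin M → Matrix (Fin n) (Fin n) ℝ)
    (b : Fin M → EuclideanSpace ℝ (Fin n)) (σ : SwitchingSignal M)
    (x₀ : EuclideanSpace ℝ (Fin n)) :
    ∃ x, IsSolution A b σ x₀ x ∧ ∀ t : ℝ≥0, x t = flow A b σ t x₀ :=
  ⟨_, (exists_isSolution A b σ x₀).choose_spec, fun _ => rfl⟩

theorem flow_constantSignal_sub (A : Fin M → Matrix (Fin n) (Fin n) ℝ)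
    (b : Fin M → EuclideanSpace ℝ (Fin n)) (i : Fin M) (t : ℝ≥0)
    (x y : EuclideanSpace ℝ (Fin n)) :
    flow A b (constantSignal i) t x - flow A b (constantSignal i) t y =
      NormedSpace.exp ((t : ℝ) • modeOperator A i) (x - y) := by
  obtain ⟨u, hu, hut⟩ := isSolution_flow A b (constantSignal i) x
  obtain ⟨v, hv, hvt⟩ := isSolution_flow A b (constantSignal i) y
  have h := eq_exp_of_hasDerivWithinAt (L := modeOperator A i) (x := fun t => u t - v t)
    t.2 ((hu.2.1.sub hv.2.1).mono Icc_subset_Ici_self) fun r hr => by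
      have h := (hu.2.2 r hr.1).sub (hv.2.2 r hr.1)
      -- Both trajectories follow the same mode, so the affine terms cancel.
      simp only [field, constantSignal, add_sub_add_right_eq_sub, ← map_sub] at h
      exact h
  rw [← hut, ← hvt, ← hu.1, ← hv.1]
  simpa using h

/-- A word in the mode flows may switch too fast for dwell time `τ`. No single admissible signal has
to realize it: invariance is applied one letter at a time, restarting from a point of `C` with a
constant signal. -/
theorem ForwardInvariantOn.exists_apply_sub_eq {A : Fin M → Matrix (Fin n) (Fin n) ℝ}
    {b : Fin M → EuclideanSpace ℝ (Fin n)} {τ : ℝ} {C : Set (EuclideanSpace ℝ (Fin n))}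
    (hC : ForwardInvariantOn A b (dwellTimeSignals M τ) C)
    {g : EuclideanSpace ℝ (Fin n) →L[ℝ] EuclideanSpace ℝ (Fin n)}
    (hg : g ∈ modeSemigroup (modeOperator A)) :
    ∀ x ∈ C, ∀ y ∈ C, ∃ x' ∈ C, ∃ y' ∈ C, g (x - y) = x' - y' := by
  induction hg using Submonoid.closure_induction with
  | mem g hg =>
    obtain ⟨i, t, ht, rfl⟩ := hg
    intro x hx y hy
    have hi := constantSignal_mem_dwellTimeSignals i τ
    exact ⟨_, hC x hx _ hi ⟨t, ht⟩, _, hC y hy _ hi ⟨t, ht⟩,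
      (flow_constantSignal_sub A b i ⟨t, ht⟩ x y).symm⟩
  | one => exact fun x hx y hy => ⟨x, hx, y, hy, rfl⟩
  | mul g h _ _ ihg ihh =>
    intro x hx y hy
    obtain ⟨x', hx', y', hy', h1⟩ := ihh x hx y hy
    obtain ⟨x'', hx'', y'', hy'', h2⟩ := ihg x' hx' y' hy'
    exact ⟨x'', hx'', y'', hy'', by rw [← h2, ← h1]; rfl⟩

theorem ForwardInvariantOn.sub_mem_boundedOrbits {A : Fin M → Matrix (Fin n) (Fin n) ℝ}
    {b : Fin M → EuclideanSpace ℝ (Fin n)} {τ : ℝ} {C : Set (EuclideanSpace ℝ (Fin n))}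
    (hC : ForwardInvariantOn A b (dwellTimeSignals M τ) C) (hb : Bornology.IsBounded C)
    {x y : EuclideanSpace ℝ (Fin n)} (hx : x ∈ C) (hy : y ∈ C) :
    x - y ∈ boundedOrbits (modeSemigroup (modeOperator A)) := by
  refine ⟨Metric.diam C, fun g hg => ?_⟩
  obtain ⟨x', hx', y', hy', h⟩ := hC.exists_apply_sub_eq hg x hx y hy
  rw [h, ← dist_eq_norm]
  exact Metric.dist_le_diam_of_mem hb hx' hy'

/-! ### Linearized trajectories as semigroup orbits -/

theorem IsSolution.eq_exp_of_no_switch {A : Fin M → Matrix (Fin n) (Fin n) ℝ}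
    {σ : SwitchingSignal M} {x₀ : EuclideanSpace ℝ (Fin n)} {x : ℝ → EuclideanSpace ℝ (Fin n)}
    (hx : IsSolution A 0 σ x₀ x) {s T : ℝ} (hs : 0 ≤ s) (hsT : s ≤ T)
    (h : ∀ t ∈ Ioo s T, t.toNNReal ∉ σ.switchingTimes) :
    x T = NormedSpace.exp ((T - s) • modeOperator A (σ.toFun s.toNNReal)) (x s) := by
  refine eq_exp_of_hasDerivWithinAt hsT
    (hx.2.1.mono fun t ht => hs.trans ht.1) fun t ht => ?_
  have hd := hx.2.2 t (hs.trans ht.1)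
  rw [field, σ.eq_of_no_switch h ht, Pi.zero_apply, add_zero] at hd
  exact hd

/-- Induction on the number of switches in `(0, T)`: cut at the last one, after which a single
exponential acts. No lower bound on durations is needed, so arbitrary signals are covered. -/
theorem IsSolution.exists_mem_modeSemigroup {A : Fin M → Matrix (Fin n) (Fin n) ℝ}
    {σ : SwitchingSignal M} {x₀ : EuclideanSpace ℝ (Fin n)} {x : ℝ → EuclideanSpace ℝ (Fin n)}
    (hx : IsSolution A 0 σ x₀ x) {T : ℝ} (hT : 0 ≤ T) :
    ∃ g ∈ modeSemigroup (modeOperator A), x T = g x₀ := by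
  have hfin : ∀ T : ℝ, {t : ℝ | t ∈ Ioo 0 T ∧ t.toNNReal ∈ σ.switchingTimes}.Finite := by
    intro T
    refine ((σ.finite_discontinuities T.toNNReal).image ((↑) : ℝ≥0 → ℝ)).subset ?_
    rintro t ⟨ht, hts⟩
    exact ⟨t.toNNReal, ⟨Real.toNNReal_le_toNNReal ht.2.le, hts⟩, Real.coe_toNNReal t ht.1.le⟩
  have step : ∀ s T : ℝ, 0 ≤ s → s ≤ T → (∃ g ∈ modeSemigroup (modeOperator A), x s = g x₀) →
      (∀ t ∈ Ioo s T, t.toNNReal ∉ σ.switchingTimes) →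
      ∃ g ∈ modeSemigroup (modeOperator A), x T = g x₀ := by
    rintro s T hs hsT ⟨g, hg, hgs⟩ h
    refine ⟨_, mul_mem (Submonoid.subset_closure
      ⟨σ.toFun s.toNNReal, T - s, sub_nonneg.2 hsT, rfl⟩) hg, ?_⟩
    rw [hx.eq_exp_of_no_switch hs hsT h, hgs]
    rfl
  induction hk : {t : ℝ | t ∈ Ioo 0 T ∧ t.toNNReal ∈ σ.switchingTimes}.ncard
    using Nat.strong_induction_on generalizing T with
  | _ k ih =>
    rcases Set.eq_empty_or_nonempty
      {t : ℝ | t ∈ Ioo 0 T ∧ t.toNNReal ∈ σ.switchingTimes} with he | hne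
    · exact step 0 T le_rfl hT ⟨1, one_mem _, hx.1⟩ fun t ht hts =>
        (Set.eq_empty_iff_forall_notMem.1 he t) ⟨ht, hts⟩
    · obtain ⟨s, hsD, hmax⟩ := Set.exists_max_image _ id (hfin T) hne
      have hlt : {t : ℝ | t ∈ Ioo 0 s ∧ t.toNNReal ∈ σ.switchingTimes}.ncard < k := by
        rw [← hk]
        refine Set.ncard_lt_ncard ⟨?_, ?_⟩ (hfin T)
        · exact fun t ht => ⟨⟨ht.1.1, ht.1.2.trans hsD.1.2⟩, ht.2⟩
        · exact fun hsub => lt_irrefl s (hsub hsD).1.2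
      refine step s T hsD.1.1.le hsD.1.2.le (ih _ hlt hsD.1.1.le rfl) fun t ht hts => ?_
      exact absurd (hmax t ⟨⟨hsD.1.1.trans ht.1, ht.2⟩, hts⟩) (not_le.2 ht.1)

theorem LinearizationUnstableOn.boundedOrbits_ne_top {A : Fin M → Matrix (Fin n) (Fin n) ℝ}
    {𝒮 : Set (SwitchingSignal M)} (h : LinearizationUnstableOn A 𝒮) :
    boundedOrbits (modeSemigroup (modeOperator A)) ≠ ⊤ := by
  intro htop
  obtain ⟨x₀, σ, -, hlim⟩ := h
  obtain ⟨D, hD⟩ : x₀ ∈ boundedOrbits (modeSemigroup (modeOperator A)) := htop ▸ trivial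
  obtain ⟨x, hx, hxt⟩ := isSolution_flow A 0 σ x₀
  have hle : limsup (fun t : ℝ≥0 => ((‖linearizedFlow A σ t x₀‖ : ℝ) : EReal)) atTop
      ≤ (D : EReal) := by
    refine limsup_le_of_le (h := Eventually.of_forall fun t => ?_)
    obtain ⟨g, hg, hgt⟩ := hx.exists_mem_modeSemigroup t.2
    have := hD g hg
    rw [← hgt] at this
    rw [linearizedFlow, ← hxt]
    exact EReal.coe_le_coe_iff.2 this
  rw [hlim, top_le_iff] at hle
  exact EReal.coe_ne_top D hle

/-! ### Interior points and conclusion -/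

theorem submodule_eq_top_of_sub_mem {E : Type*} [NormedAddCommGroup E] [NormedSpace ℝ E]
    {W : Submodule ℝ E} {C : Set E} (hC : (interior C).Nonempty)
    (h : ∀ x ∈ C, ∀ y ∈ C, x - y ∈ W) : W = ⊤ := by
  obtain ⟨c, hc⟩ := hC
  -- For an interior point `c` of `C`, the translate `C - c` is a neighbourhood of `0` contained in
  -- `W`.
  refine W.eq_top_of_nonempty_interior' ⟨0, mem_interior_iff_mem_nhds.2 ?_⟩
  have hcont : Tendsto (fun x : E => x + c) (𝓝 0) (𝓝 c) := by
    have := (continuous_add_const c).tendsto (0 : E)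
    rwa [zero_add] at this
  filter_upwards [hcont (mem_interior_iff_mem_nhds.1 hc)] with x hx
  simpa using h _ hx c (interior_subset hc)

end SwitchedAffine

theorem mainTheorem5 {n M : ℕ} (A : Fin M → Matrix (Fin n) (Fin n) ℝ)
    (b : Fin M → EuclideanSpace ℝ (Fin n))
    (hunstable : SwitchedAffine.LinearizationUnstableOn A Set.univ) :
    (∀ τ : ℝ, 0 < τ →
      ¬ ∃ C : Set (EuclideanSpace ℝ (Fin n)), IsCompact C ∧ (interior C).Nonempty ∧
        SwitchedAffine.ForwardInvariantOn A b (SwitchedAffine.dwellTimeSignals M τ) C) ∧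
    (SwitchedAffine.IrreducibleFamily A → ∀ τ : ℝ, 0 < τ →
      ¬ ∃ C : Set (EuclideanSpace ℝ (Fin n)), IsCompact C ∧ C.Nonempty ∧ (¬ ∃ c, C = {c}) ∧
        SwitchedAffine.ForwardInvariantOn A b (SwitchedAffine.dwellTimeSignals M τ) C) := by
  have hne := hunstable.boundedOrbits_ne_top
  constructor
  · rintro τ - ⟨C, hcomp, hint, hinv⟩
    exact hne (SwitchedAffine.submodule_eq_top_of_sub_mem hint fun x hx y hy =>
      hinv.sub_mem_boundedOrbits hcomp.isBounded hx hy)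
  · rintro hirr τ - ⟨C, hcomp, hnon, hsing, hinv⟩
    rcases hirr _ fun i w hw => SwitchedAffine.apply_mem_boundedOrbits _ i hw with h | h
    · obtain ⟨c, hc⟩ := hnon
      refine hsing ⟨c, Set.eq_singleton_iff_unique_mem.2 ⟨hc, fun x hx => ?_⟩⟩
      have hmem := hinv.sub_mem_boundedOrbits hcomp.isBounded hx hc
      rw [h, Submodule.mem_bot] at hmem
      exact sub_eq_zero.1 hmem
    · exact hne h
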